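/- Consider the Multi-leader Angelfish protocol run by $n$ parties, of which at most $f<n/3$ are Byzantine (arbitrary behaviour), with authenticated (signed) messages, adversarial message scheduling, and a reliable broadcast in which honest parties never deliver two different values for the same sender and round. Each round $r\ge 1$ has a fixed non-empty ordered list $\mathcal{ML}_r$ of leaders; $\mathcal{ML}_r[1]$ is the main leader, the others are secondary leaders. A (main) leader vertex of round $r$ is a round-$r$ vertex proposed by a (the main) leader of round $r$. Each honest party keeps a local DAG of delivered vertices. A round-$r$ vertex has strong edges to round-$(r-1)$ vertices, weak edges to vertices of rounds $<r-1$ and, if it is a leader vertex, possibly leader edges to leader vertices of rounds $<r-1$. A leader path is a path consisting of strong and leader edges all of whose vertices are leader vertices. The rules are as follows. * In each round an honest party proposes at most one vertex (by reliable broadcast) or sends at most one vote, not both. Its round-$(r+1)$ vertex has strong edges to the round-$r$ vertices in its DAG; its round-$(r+1)$ vote supports the round-$r$ leader vertices in its DAG if the main one is among them, and none otherwise. An honest party may send a timeout message for round $r$ only while it is in round $r$ and has not delivered the round-$r$ main leader vertex; then its round-$(r+1)$ vertex has no strong edge to that vertex, and its round-$(r+1)$ vote supports no vertex. After entering a round above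 $r$ it may send a no-vote message against a leader $\ell\in\mathcal{ML}_r$ whose round-$r$ vertex it has not delivered; if it does so before creating its round-$(r+1)$ vertex or vote, that vertex or vote does not reference the round-$r$ vertex of $\ell$. * An honest party adds a main leader vertex of round $\rho$ to its DAG only if it is valid: for some $r'<\rho$ the vertex contains a timeout certificate ($n-f$ timeout messages of distinct parties) for every round $r''$ with $r'<r''<\rho$, and either $r'=0$, or for some $x\ge1$ it has leader paths to round-$r'$ vertices of all leaders in $\mathcal{ML}_{r'}[:x]$ and, unless $x=|\mathcal{ML}_{r'}|$, contains a no-vote certificate ($n-f$ no-vote messages of distinct parties) against $\mathcal{ML}_{r'}[x+1]$ for round $r'$. * An honest party directly commits a vertex $v$ in its DAG that was proposed in round $r$ by $\mathcal{ML}_r[x]$ when it has received, from $n-f$ distinct parties, first reliable-broadcast messages of round-$(r+1)$ vertices or round-$(r+1)$ votes with a strong edge to $v$, and it has directly committed the round-$r$ vertices of all leaders in $\mathcal{ML}_r[:x-1]$. Claim. In every run: if an honest party $P_i$ directly commits a (main or secondary) leader vertex $v_k$ of round $r$, then for every main leader vertex $v_\ell$ of a round $r'>r$ in the DAG of any honest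 party $P_j$, there is a leader path from $v_\ell$ to $v_k$ in the DAG of $P_j$. -/

import Mathlib

/-! An operational model of the Multi-leader Angelfish protocol: an asynchronous, adversarially
scheduled message-passing system of `n` parties, in which honest parties follow the protocol and
Byzantine parties behave arbitrarily.

Conditions of the protocol that merely delay an honest party (the length of the timer, the number
of vertices to wait for before proposing, ...) are not imposed, and certificates that are forwarded are
received as the individual messages they consist of.  Every run of the protocol is therefore a run of
the model. -/

namespace Angelfish

/-- A timeout certificate `TC_round`: the parties whose signed timeout messages it collects. -/
structure TimeoutCert (n : ℕ) where
  round : ℕ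
  signers : Finset (Fin n)

/-- A no-vote certificate `NVC_round^leader`: the parties whose signed no-vote messages for the
leader `leader` of round `round` it collects. -/
structure NoVoteCert (n : ℕ) where
  leader : Fin n
  round : ℕ
  signers : Finset (Fin n)

/-- A vertex of the DAG.  Edges carry the referenced vertices by value (in practice, by a
collision-free hash). -/
structure Vertex (n : ℕ) where
  round : ℕ
  source : Fin n
  block : List ℕ
  propose : Bool
  strongEdges : List (Vertex n)
  weakEdges : List (Vertex n)
  leaderEdges : List (Vertex n)
  tc : List (TimeoutCert n)
  nvc : Option (NoVoteCert n)

/-- A vote; an empty `strongEdges` means that no leader vertex is supported. -/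
structure Vote (n : ℕ) where
  round : ℕ
  source : Fin n
  propose : Bool
  strongEdges : List (Vertex n)

/-- Signed point-to-point messages.  `first v` is the first message of the reliable broadcast by
which `v.source` propagates `v`. -/
inductive Msg (n : ℕ) where
  | timeout (p : Fin n) (r : ℕ)
  | noVote (p : Fin n) (l : Fin n) (r : ℕ)
  | vote (vt : Vote n)
  | first (v : Vertex n)

/-- The party that signs and sends a message. -/
def Msg.sender {n : ℕ} : Msg n → Fin n
  | .timeout p _ => p
  | .noVote p _ _ => p
  | .vote vt => vt.source
  | .first v => v.source

/-- The data fixed before a run: the bound `f` on the number of faults, the set of Byzantine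
parties, and the ordered list of leaders of each round (the head is the main leader). -/
structure Params (n : ℕ) where
  f : ℕ
  byz : Finset (Fin n)
  leaders : ℕ → List (Fin n)

variable {n : ℕ}

/-- `p` is the main leader of round `r`. -/
def Params.IsMainLeader (P : Params n) (p : Fin n) (r : ℕ) : Prop :=
  (P.leaders r).head? = some p

/-- A vertex proposed by one of the (main or secondary) leaders of its round. -/
def IsLeaderVertex (P : Params n) (v : Vertex n) : Prop :=
  v.source ∈ P.leaders v.round

/-- A vertex proposed by the main leader of its round. -/
def IsMainLeaderVertex (P : Params n) (v : Vertex n) : Prop :=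
  P.IsMainLeader v.source v.round

/-- There is a leader edge or a strong edge from the leader vertex `a` to the leader vertex `b`,
where `b` belongs to the DAG `D`. -/
def LeaderStep (P : Params n) (D : Set (Vertex n)) (a b : Vertex n) : Prop :=
  IsLeaderVertex P a ∧ IsLeaderVertex P b ∧ b ∈ D ∧ (b ∈ a.leaderEdges ∨ b ∈ a.strongEdges)

/-- `leader_path(v, u)` in the DAG `D`: there are leader vertices `v = v₁, …, v_k = u` such that
each of `v₂, …, v_k` is in `D` and is reached from its predecessor by a leader or strong edge. -/
def LeaderPath (P : Params n) (D : Set (Vertex n)) (v u : Vertex n) : Prop :=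
  IsLeaderVertex P v ∧ Relation.ReflTransGen (LeaderStep P D) v u

/-- The certificate collects `n - f` timeout messages for its round, all contained in `K`. -/
def TimeoutCert.Verified (P : Params n) (K : Set (Msg n)) (c : TimeoutCert n) : Prop :=
  n - P.f ≤ c.signers.card ∧ ∀ p ∈ c.signers, Msg.timeout p c.round ∈ K

/-- The certificate collects `n - f` no-vote messages for its leader and round, all in `K`. -/
def NoVoteCert.Verified (P : Params n) (K : Set (Msg n)) (c : NoVoteCert n) : Prop :=
  n - P.f ≤ c.signers.card ∧ ∀ p ∈ c.signers, Msg.noVote p c.leader c.round ∈ K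

/-- The format of a vertex: strong edges lead to the previous round, weak and leader edges to
earlier rounds, and leader edges connect leader vertices. -/
def WellFormed (P : Params n) (v : Vertex n) : Prop :=
  1 ≤ v.round ∧
  (∀ u ∈ v.strongEdges, u.round + 1 = v.round) ∧
  (∀ u ∈ v.weakEdges, u.round + 1 < v.round) ∧
  (∀ u ∈ v.leaderEdges, u.round + 1 < v.round ∧ IsLeaderVertex P u ∧ IsLeaderVertex P v)

/-- `is_valid(v)` for a main leader vertex `v`, relative to the messages `K` whose signatures verify
and the local DAG `D`.  For some earlier round `r'`, the vertex
* contains a timeout certificate for every round strictly between `r'` and its own, and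
* unless `r' = 0` (there is no main leader vertex to refer to), has leader paths to vertices of the
  first `x ≥ 1` leaders of round `r'`, and contains a no-vote certificate for the next leader of
  round `r'` unless these are all the leaders of round `r'`.
If `r'` is the preceding round, no timeout certificate is needed and the leader paths are strong
edges. -/
def MainValid (P : Params n) (K : Set (Msg n)) (D : Set (Vertex n)) (v : Vertex n) : Prop :=
  ∃ r' < v.round,
    (∀ r'', r' < r'' → r'' < v.round → ∃ c ∈ v.tc, c.round = r'' ∧ c.Verified P K) ∧
    (r' = 0 ∨
      ∃ x, 1 ≤ x ∧ x ≤ (P.leaders r').length ∧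
        (∀ y < x, ∃ u ∈ D, u.round = r' ∧ (P.leaders r')[y]? = some u.source ∧
          LeaderPath P D v u) ∧
        (x = (P.leaders r').length ∨
          ∃ c, v.nvc = some c ∧ c.round = r' ∧ (P.leaders r')[x]? = some c.leader ∧
            c.Verified P K))

/-- The local state of a party. -/
structure LocalState (n : ℕ) where
  /-- the current round -/
  round : ℕ
  /-- the local DAG; `DAG[r]` consists of its vertices of round `r` -/
  dag : Set (Vertex n)
  /-- the messages received so far -/
  inbox : Set (Msg n)
  /-- the rounds in which the party has proposed a vertex or has voted -/
  acted : Set ℕ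
  /-- the vertices that the party has directly committed -/
  committed : Set (Vertex n)
  /-- the last round in which it has directly committed a vertex -/
  committedRound : ℕ

/-- The global state: the local states (irrelevant for Byzantine parties), all messages sent so far,
and the outcome of the reliable broadcast instance of each sender and round (`none` as long as it is
undetermined). -/
structure State (n : ℕ) where
  loc : Fin n → LocalState n
  pool : Set (Msg n)
  rbc : Fin n → ℕ → Option (Vertex n)

/-- Replace the local state of party `i`. -/
def State.setLoc (s : State n) (i : Fin n) (l : LocalState n) : State n :=
  { s with loc := Function.update s.loc i l }

/-- The vertices of round `r` in a local DAG. -/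
def LocalState.dagAt (l : LocalState n) (r : ℕ) : Set (Vertex n) :=
  {v | v ∈ l.dag ∧ v.round = r}

/-- The votes of round `r` that have been received. -/
def LocalState.votesAt (l : LocalState n) (r : ℕ) : Set (Vote n) :=
  {vt | Msg.vote vt ∈ l.inbox ∧ vt.round = r}

/-- The local DAG contains a round `r` vertex of party `p`. -/
def LocalState.Has (l : LocalState n) (p : Fin n) (r : ℕ) : Prop :=
  ∃ v ∈ l.dag, v.round = r ∧ v.source = p

/-- The local DAG contains the main leader vertex of round `r`. -/
def LocalState.HasMain (P : Params n) (l : LocalState n) (r : ℕ) : Prop :=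
  ∃ v ∈ l.dag, v.round = r ∧ IsMainLeaderVertex P v

/-- A timeout certificate for round `r` has been received. -/
def LocalState.HasTC (P : Params n) (l : LocalState n) (r : ℕ) : Prop :=
  ∃ c : TimeoutCert n, c.round = r ∧ c.Verified P l.inbox

/-- Party `i` is free to support, in its next vertex or vote, the vertex `u` of its DAG: it has not
sent a timeout message for the round of `u` if `u` is a main leader vertex, and it has not sent a
no-vote message against `u`. -/
def MaySupport (P : Params n) (s : State n) (i : Fin n) (u : Vertex n) : Prop :=
  u ∈ (s.loc i).dag ∧
  ¬ (IsMainLeaderVertex P u ∧ Msg.timeout i u.round ∈ s.pool) ∧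
  Msg.noVote i u.source u.round ∉ s.pool

/-- `create_new_vertex`: the vertices that party `i` may create in its current round. -/
def CreatesVertex (P : Params n) (s : State n) (i : Fin n) (v : Vertex n) : Prop :=
  v.source = i ∧ v.round = (s.loc i).round ∧ WellFormed P v ∧
  (∀ u, u ∈ v.strongEdges ↔ u.round + 1 = v.round ∧ MaySupport P s i u) ∧
  (∀ u ∈ v.weakEdges, u ∈ (s.loc i).dag) ∧
  (∀ u ∈ v.leaderEdges, u ∈ (s.loc i).dag) ∧
  (IsMainLeaderVertex P v → MainValid P (s.loc i).inbox (s.loc i).dag v) ∧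
  (¬ IsMainLeaderVertex P v → v.leaderEdges = [] ∧ v.tc = [] ∧ v.nvc = none)

/-- `create_new_vote`: the votes that party `i` may create in its current round.  It votes for all
leader vertices of the previous round in its DAG, provided that the main one is among them and that
it has sent no timeout message for that round; otherwise it votes for none. -/
def CreatesVote (P : Params n) (s : State n) (i : Fin n) (vt : Vote n) : Prop :=
  vt.source = i ∧ vt.round = (s.loc i).round ∧
  ∀ u, u ∈ vt.strongEdges ↔
    u.round + 1 = vt.round ∧ IsLeaderVertex P u ∧ MaySupport P s i u ∧
    Msg.timeout i u.round ∉ s.pool ∧ (s.loc i).HasMain P u.round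

/-- Among the messages `K` there are, from `n - f` distinct parties, first messages of vertices or
votes of the next round with a strong edge to `v`. -/
def Supported (P : Params n) (K : Set (Msg n)) (v : Vertex n) : Prop :=
  ∃ Q : Finset (Fin n), n - P.f ≤ Q.card ∧ ∀ p ∈ Q,
    (∃ w, Msg.first w ∈ K ∧ w.source = p ∧ w.round = v.round + 1 ∧ v ∈ w.strongEdges) ∨
    (∃ vt, Msg.vote vt ∈ K ∧ vt.source = p ∧ vt.round = v.round + 1 ∧ v ∈ vt.strongEdges)

/-- One step of the system. -/
inductive Step (P : Params n) : State n → State n → Prop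
  /-- A Byzantine party sends an arbitrary message (under its own signature). -/
  | byzSend (s : State n) (m : Msg n) (hm : m.sender ∈ P.byz) :
      Step P s { s with pool := insert m s.pool }
  /-- The reliable broadcast of a Byzantine sender gets an arbitrary outcome, once and for all. -/
  | byzBroadcast (s : State n) (p : Fin n) (r : ℕ) (v : Vertex n) (hp : p ∈ P.byz)
      (h : s.rbc p r = none) :
      Step P s { s with rbc := Function.update s.rbc p (Function.update (s.rbc p) r (some v)) }
  /-- A message reaches an honest party.  Of the reliable broadcast of a given sender and round,
  only the first message counts. -/
  | receive (s : State n) (i : Fin n) (m : Msg n) (hi : i ∉ P.byz) (hm : m ∈ s.pool)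
      (hfirst : ∀ v w, m = Msg.first v → Msg.first w ∈ (s.loc i).inbox →
        w.source = v.source → w.round = v.round → w = v) :
      Step P s (s.setLoc i { s.loc i with inbox := insert m (s.loc i).inbox })
  /-- An honest party delivers the outcome of a reliable broadcast and adds it to its DAG: the
  vertex is well formed, valid if it is a main leader vertex, and all its references are in the
  DAG already. -/
  | deliver (s : State n) (i : Fin n) (v : Vertex n) (hi : i ∉ P.byz)
      (hv : s.rbc v.source v.round = some v) (hwf : WellFormed P v)
      (hrefs : ∀ u, u ∈ v.strongEdges ∨ u ∈ v.weakEdges ∨ u ∈ v.leaderEdges → u ∈ (s.loc i).dag)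
      (hvalid : IsMainLeaderVertex P v → MainValid P s.pool (s.loc i).dag v) :
      Step P s (s.setLoc i { s.loc i with dag := insert v (s.loc i).dag })
  /-- The timer of an honest party expires before it has delivered the main leader vertex of its
  current round: it sends a timeout message. -/
  | timeout (s : State n) (i : Fin n) (hi : i ∉ P.byz)
      (h : ¬ (s.loc i).HasMain P (s.loc i).round) :
      Step P s { s with pool := insert (Msg.timeout i (s.loc i).round) s.pool }
  /-- An honest party enters round `r + 1`, where `r` is at least its current round, after it has
  obtained `n - f` vertices and votes of round `r` (`f + 1` suffice to jump ahead), and the main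
  leader vertex of round `r` or a timeout certificate for round `r`. -/
  | advance (s : State n) (i : Fin n) (r : ℕ) (hi : i ∉ P.byz) (hr : (s.loc i).round ≤ r)
      (hcount : ((n - P.f : ℕ) : ℕ∞) ≤
          ((s.loc i).votesAt r).encard + ((s.loc i).dagAt r).encard ∨
        ((s.loc i).round < r ∧ ((P.f + 1 : ℕ) : ℕ∞) ≤
          ((s.loc i).votesAt r).encard + ((s.loc i).dagAt r).encard))
      (hlead : (s.loc i).HasMain P r ∨ (s.loc i).HasTC P r) :
      Step P s (s.setLoc i { s.loc i with round := r + 1 })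
  /-- Having left round `r`, an honest party sends a no-vote message against a leader `l` of round
  `r` whose vertex it has not delivered. -/
  | noVote (s : State n) (i : Fin n) (l : Fin n) (r : ℕ) (hi : i ∉ P.byz) (hr : 1 ≤ r)
      (hround : r < (s.loc i).round) (hl : l ∈ P.leaders r) (h : ¬ (s.loc i).Has l r) :
      Step P s { s with pool := insert (Msg.noVote i l r) s.pool }
  /-- An honest party proposes a vertex in its current round: it adds it to its own DAG and
  reliably broadcasts it. -/
  | propose (s : State n) (i : Fin n) (v : Vertex n) (hi : i ∉ P.byz)
      (hacted : (s.loc i).round ∉ (s.loc i).acted) (hv : CreatesVertex P s i v) :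
      Step P s
        { loc := Function.update s.loc i
            { s.loc i with
              dag := insert v (s.loc i).dag
              acted := insert (s.loc i).round (s.loc i).acted }
          pool := insert (Msg.first v) s.pool
          rbc := Function.update s.rbc i (Function.update (s.rbc i) v.round (some v)) }
  /-- An honest party other than the main leader of its current round votes instead. -/
  | vote (s : State n) (i : Fin n) (vt : Vote n) (hi : i ∉ P.byz)
      (hacted : (s.loc i).round ∉ (s.loc i).acted)
      (hmain : ¬ P.IsMainLeader i (s.loc i).round) (hvt : CreatesVote P s i vt) :
      Step P s
        { loc := Function.update s.loc i
            { s.loc i with acted := insert (s.loc i).round (s.loc i).acted }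
          pool := insert (Msg.vote vt) s.pool
          rbc := s.rbc }
  /-- An honest party directly commits the vertex `v` of the leader number `x` (counted from `0`)
  of a round: `v` has enough support, and the vertices of all preceding leaders of that round have
  been directly committed. -/
  | commit (s : State n) (i : Fin n) (v : Vertex n) (x : ℕ) (hi : i ∉ P.byz)
      (hv : v ∈ (s.loc i).dag) (hx : (P.leaders v.round)[x]? = some v.source)
      (hround : (s.loc i).committedRound ≤ v.round)
      (hprev : ∀ y < x, ∃ u ∈ (s.loc i).committed,
        u.round = v.round ∧ (P.leaders v.round)[y]? = some u.source)
      (hsupp : Supported P (s.loc i).inbox v) :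
      Step P s (s.setLoc i
        { s.loc i with
          committed := insert v (s.loc i).committed
          committedRound := v.round })

/-- The initial state: all parties are in round `1` and nothing has been sent. -/
def State.init (n : ℕ) : State n where
  loc := fun _ =>
    { round := 1, dag := ∅, inbox := ∅, acted := ∅, committed := ∅, committedRound := 0 }
  pool := ∅
  rbc := fun _ _ => none

/-- The states that occur in runs of the protocol. -/
def Reachable (P : Params n) (s : State n) : Prop :=
  Relation.ReflTransGen (Step P) (State.init n) s

/-- Party `i` has directly committed the vertex `v`. -/
def DirectlyCommits (s : State n) (i : Fin n) (v : Vertex n) : Prop :=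
  v ∈ (s.loc i).committed

end Angelfish

/-! Suppose `vk`, of round `r`, is directly committed.  The argument is a strong induction on the
round of the main leader vertex `vl`.  Since `vl` is valid, it has leader paths to vertices of the
first leaders of some earlier round `ρ`, and timeout certificates for all rounds in between.

* If `r < ρ`, one of the leader paths ends in the main leader vertex of round `ρ`, from which the
  induction hypothesis leads to `vk`.
* If `ρ = r`, either one of the leader paths ends in a vertex with the sender and round of `vk`,
  which is `vk` by agreement of the reliable broadcast (`Reachable.dag_agree`), or `vl` carries a
  no-vote certificate against a leader that does not come after the leader of `vk`.
* If `ρ < r`, then `vl` carries a timeout certificate for round `r`.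

The certificates of the last two cases cannot exist.  Direct commits proceed in the order of the
leaders, so the vertex `u` of the leader in question (the main leader in the case of a timeout) has
been committed as well, and is supported by `n - f` parties (`Reachable.exists_supported`).  As
`3 f < n`, some honest party has both supported `u` and contributed to the certificate
(`exists_honest_mem_inter`).  An honest party does not do both, in either order
(`Reachable.maySupport`): it supports only vertices of its DAG against which it has sent nothing,
and sends nothing against vertices of its DAG. -/

namespace Angelfish

variable {n : ℕ} {P : Params n} {s t : State n}

/-! ### Monotonicity of validity and support -/

lemma LeaderPath.mono {D E : Set (Vertex n)} (h : D ⊆ E) {a b : Vertex n}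
    (hp : LeaderPath P D a b) : LeaderPath P E a b :=
  ⟨hp.1, hp.2.lift id fun _ _ hs => ⟨hs.1, hs.2.1, h hs.2.2.1, hs.2.2.2⟩⟩

lemma LeaderPath.trans {D : Set (Vertex n)} {a b c : Vertex n}
    (hab : LeaderPath P D a b) (hbc : LeaderPath P D b c) : LeaderPath P D a c :=
  ⟨hab.1, hab.2.trans hbc.2⟩

lemma TimeoutCert.Verified.mono {K L : Set (Msg n)} (h : K ⊆ L) {c : TimeoutCert n}
    (hc : c.Verified P K) : c.Verified P L :=
  ⟨hc.1, fun p hp => h (hc.2 p hp)⟩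

lemma NoVoteCert.Verified.mono {K L : Set (Msg n)} (h : K ⊆ L) {c : NoVoteCert n}
    (hc : c.Verified P K) : c.Verified P L :=
  ⟨hc.1, fun p hp => h (hc.2 p hp)⟩

lemma MainValid.mono {K L : Set (Msg n)} {D E : Set (Vertex n)} (hK : K ⊆ L) (hD : D ⊆ E)
    {v : Vertex n} (hv : MainValid P K D v) : MainValid P L E v := by
  obtain ⟨ρ, hρ, htc, hlead⟩ := hv
  refine ⟨ρ, hρ, fun k h₁ h₂ => ?_, hlead.imp_right ?_⟩
  · obtain ⟨c, hc, hr, hver⟩ := htc k h₁ h₂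
    exact ⟨c, hc, hr, hver.mono hK⟩
  · rintro ⟨x, hx, hxl, hpath, hnvc⟩
    refine ⟨x, hx, hxl, fun y hy => ?_, hnvc.imp_right ?_⟩
    · obtain ⟨u, hu, hr, hs, hp⟩ := hpath y hy
      exact ⟨u, hD hu, hr, hs, hp.mono hD⟩
    · rintro ⟨c, hc, hr, hl, hver⟩
      exact ⟨c, hc, hr, hl, hver.mono hK⟩

/-- Party `p` supports the vertex `u` by a message in `K`. -/
def Supports (K : Set (Msg n)) (p : Fin n) (u : Vertex n) : Prop :=
  (∃ w, Msg.first w ∈ K ∧ w.source = p ∧ u ∈ w.strongEdges) ∨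
    ∃ vt, Msg.vote vt ∈ K ∧ vt.source = p ∧ u ∈ vt.strongEdges

lemma Supported.mono {K L : Set (Msg n)} (h : K ⊆ L) {v : Vertex n} (hv : Supported P K v) :
    Supported P L v := by
  obtain ⟨Q, hQ, hsupp⟩ := hv
  exact ⟨Q, hQ, fun p hp => (hsupp p hp).imp
    (fun ⟨w, hw, hrest⟩ => ⟨w, h hw, hrest⟩) (fun ⟨vt, hvt, hrest⟩ => ⟨vt, h hvt, hrest⟩)⟩

lemma Supported.exists_supports {K : Set (Msg n)} {v : Vertex n} (hv : Supported P K v) :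
    ∃ Q : Finset (Fin n), n - P.f ≤ Q.card ∧ ∀ p ∈ Q, Supports K p v := by
  obtain ⟨Q, hQ, hsupp⟩ := hv
  exact ⟨Q, hQ, fun p hp => (hsupp p hp).imp
    (fun ⟨w, hw, hsrc, _, hv⟩ => ⟨w, hw, hsrc, hv⟩)
    (fun ⟨vt, hvt, hsrc, _, hv⟩ => ⟨vt, hvt, hsrc, hv⟩)⟩

/-- Two quorums of `n - f` parties share an honest party. -/
lemma exists_honest_mem_inter (hf : 3 * P.f < n) (hbyz : P.byz.card ≤ P.f)
    {Q R : Finset (Fin n)} (hQ : n - P.f ≤ Q.card) (hR : n - P.f ≤ R.card) :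
    ∃ p ∈ Q, p ∈ R ∧ p ∉ P.byz := by
  have hunion : (Q ∪ R).card ≤ n := by simpa using Finset.card_le_univ (Q ∪ R)
  have hsum := Finset.card_union_add_card_inter Q R
  obtain ⟨p, hp, hpb⟩ := Finset.exists_mem_notMem_of_card_lt_card
    (s := P.byz) (t := Q ∩ R) (by omega)
  exact ⟨p, (Finset.mem_inter.1 hp).1, (Finset.mem_inter.1 hp).2, hpb⟩

/-! ### The effect of a single step -/

lemma Step.pool_mono (h : Step P s t) : s.pool ⊆ t.pool := by
  cases h <;> simp [State.setLoc]

lemma Step.dag_mono (h : Step P s t) (j : Fin n) : (s.loc j).dag ⊆ (t.loc j).dag := by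
  cases h <;> simp only [State.setLoc, Function.update_apply, subset_refl] <;> split_ifs <;>
    simp_all

lemma Step.inbox_mono (h : Step P s t) (j : Fin n) : (s.loc j).inbox ⊆ (t.loc j).inbox := by
  cases h <;> simp only [State.setLoc, Function.update_apply, subset_refl] <;> split_ifs <;>
    simp_all

lemma Step.committed_mono (h : Step P s t) (j : Fin n) :
    (s.loc j).committed ⊆ (t.loc j).committed := by
  cases h <;> simp only [State.setLoc, Function.update_apply, subset_refl] <;> split_ifs <;>
    simp_all

lemma Step.inbox_subset_pool (h : Step P s t) (hs : ∀ j, (s.loc j).inbox ⊆ s.pool) (j : Fin n) :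
    (t.loc j).inbox ⊆ t.pool := by
  have hj : (s.loc j).inbox ⊆ t.pool := (hs j).trans h.pool_mono
  cases h with
  | receive i m hi hm hfirst =>
    by_cases hij : j = i
    · subst hij
      simpa [State.setLoc, Set.insert_subset_iff, hm] using hj
    · simpa [State.setLoc, hij] using hj
  | _ =>
    simp only [State.setLoc, Function.update_apply] at hj ⊢
    first
      | exact hj
      | split_ifs with hij
        · subst hij; exact hj
        · exact hj

/-- Reliable broadcast instances of honest senders are started only by acting. -/
lemma Step.acted_of_rbc (h : Step P s t)
    (hs : ∀ j ∉ P.byz, ∀ r, s.rbc j r ≠ none → r ∈ (s.loc j).acted)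
    (j : Fin n) (hj : j ∉ P.byz) (r : ℕ) (hr : t.rbc j r ≠ none) : r ∈ (t.loc j).acted := by
  have hold := hs j hj r
  cases h with
  | byzBroadcast p r' v hp hnone =>
    have hjp : j ≠ p := fun h => hj (h ▸ hp)
    simp only [Function.update_of_ne hjp] at hr
    exact hold hr
  | propose i v hi hacted hv =>
    by_cases hij : j = i
    · subst hij
      by_cases hrv : r = v.round
      · simp [hrv, hv.2.1]
      · simp only [Function.update_self, Function.update_of_ne hrv] at hr ⊢
        exact Or.inr (hold hr)
    · simp only [Function.update_of_ne hij] at hr ⊢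
      exact hold hr
  | _ =>
    simp only [State.setLoc, Function.update_apply] at hr ⊢
    first
      | exact hold hr
      | split_ifs with hij
        · subst hij
          first
            | exact hold hr
            | exact Or.inr (hold hr)
        · exact hold hr

/-- The outcome of a reliable broadcast never changes. -/
lemma Step.rbc_stable (h : Step P s t)
    (hs : ∀ j ∉ P.byz, ∀ r, s.rbc j r ≠ none → r ∈ (s.loc j).acted)
    {p : Fin n} {r : ℕ} {v : Vertex n} (hv : s.rbc p r = some v) : t.rbc p r = some v := by
  cases h with
  | byzBroadcast p' r' w hp hnone =>
    by_cases hpp : p = p'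
    · subst hpp
      have hrr : r ≠ r' := by rintro rfl; simp [hnone] at hv
      simpa [Function.update_of_ne hrr] using hv
    · simpa [Function.update_of_ne hpp] using hv
  | propose i w hi hacted hw =>
    by_cases hpi : p = i
    · subst hpi
      have hrr : r ≠ w.round := by
        rintro rfl
        exact hacted (hw.2.1 ▸ hs p hi _ (by simp [hv]))
      simpa [Function.update_of_ne hrr] using hv
    · simpa [Function.update_of_ne hpi] using hv
  | _ => exact hv

/-- A vertex that enters a DAG is well formed, is the outcome of a reliable broadcast, and is valid
if it is a main leader vertex. -/
lemma Step.mem_dag (h : Step P s t) (hs : ∀ j, (s.loc j).inbox ⊆ s.pool) {j : Fin n}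
    {v : Vertex n} (hv : v ∈ (t.loc j).dag) :
    v ∈ (s.loc j).dag ∨ (t.rbc v.source v.round = some v ∧ WellFormed P v ∧
      (IsMainLeaderVertex P v → MainValid P s.pool (s.loc j).dag v)) := by
  cases h with
  | deliver i w hi hw hwf hrefs hvalid =>
    by_cases hij : j = i
    · subst hij
      simp only [State.setLoc, Function.update_self] at hv ⊢
      rcases hv with rfl | hv
      · exact Or.inr ⟨hw, hwf, hvalid⟩
      · exact Or.inl hv
    · simp only [State.setLoc, Function.update_of_ne hij] at hv
      exact Or.inl hv
  | propose i w hi hacted hw =>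
    by_cases hij : j = i
    · subst hij
      simp only [Function.update_self] at hv
      rcases hv with rfl | hv
      · exact Or.inr ⟨by simp [hw.1], hw.2.2.1, fun hm =>
          (hw.2.2.2.2.2.2.1 hm).mono (hs j) subset_rfl⟩
      · exact Or.inl hv
    · simp only [Function.update_of_ne hij] at hv
      exact Or.inl hv
  | _ =>
    simp only [State.setLoc, Function.update_apply] at hv
    refine Or.inl ?_
    first
      | exact hv
      | split_ifs at hv with hij
        · subst hij; exact hv
        · exact hv

/-- An honest party newly supports only vertices that it is free to support. -/
lemma Step.supports (h : Step P s t) {p : Fin n} (hp : p ∉ P.byz) {u : Vertex n}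
    (hu : Supports t.pool p u) : Supports s.pool p u ∨ MaySupport P s p u := by
  cases h with
  | byzSend m hm =>
    left
    rcases hu with ⟨w, hw, rfl, hu⟩ | ⟨vt, hvt, rfl, hu⟩
    · rcases hw with rfl | hw
      · exact absurd hm hp
      · exact Or.inl ⟨w, hw, rfl, hu⟩
    · rcases hvt with rfl | hvt
      · exact absurd hm hp
      · exact Or.inr ⟨vt, hvt, rfl, hu⟩
  | propose i v hi hacted hv =>
    rcases hu with ⟨w, hw, rfl, hu⟩ | ⟨vt, hvt, rfl, hu⟩
    · rcases hw with hw | hw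
      · cases hw
        rw [hv.1]
        exact Or.inr ((hv.2.2.2.1 u).1 hu).2
      · exact Or.inl (Or.inl ⟨w, hw, rfl, hu⟩)
    · exact Or.inl (Or.inr ⟨vt, hvt.resolve_left (by simp), rfl, hu⟩)
  | vote i v hi hacted hmain hv =>
    rcases hu with ⟨w, hw, rfl, hu⟩ | ⟨vt, hvt, rfl, hu⟩
    · exact Or.inl (Or.inl ⟨w, hw.resolve_left (by simp), rfl, hu⟩)
    · rcases hvt with hvt | hvt
      · cases hvt
        rw [hv.1]
        exact Or.inr ((hv.2.2 u).1 hu).2.2.1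
      · exact Or.inl (Or.inr ⟨vt, hvt, rfl, hu⟩)
  | _ => exact Or.inl (by simpa [Supports, State.setLoc] using hu)

/-- An honest party sends neither a timeout nor a no-vote message against a vertex in its DAG. -/
lemma Step.maySupport (h : Step P s t) {p : Fin n} (hp : p ∉ P.byz) {u : Vertex n}
    (hu : MaySupport P s p u) : MaySupport P t p u := by
  obtain ⟨hdag, hto, hnv⟩ := hu
  refine ⟨h.dag_mono p hdag, ?_⟩
  cases h with
  | byzSend m hm =>
    refine ⟨fun ⟨hmain, hmem⟩ => ?_, fun hmem => ?_⟩
    · rcases hmem with rfl | hmem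
      · exact hp hm
      · exact hto ⟨hmain, hmem⟩
    · rcases hmem with rfl | hmem
      · exact hp hm
      · exact hnv hmem
  | timeout i hi hno =>
    refine ⟨fun ⟨hmain, hmem⟩ => ?_, by simpa using hnv⟩
    rcases hmem with hmem | hmem
    · obtain ⟨rfl, hround⟩ := Msg.timeout.inj hmem
      exact hno ⟨u, hdag, hround, hmain⟩
    · exact hto ⟨hmain, hmem⟩
  | noVote i l r hi hr hround hl hno =>
    refine ⟨by simpa using hto, fun hmem => ?_⟩
    rcases hmem with hmem | hmem
    · obtain ⟨rfl, hsrc, hrnd⟩ := Msg.noVote.inj hmem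
      exact hno ⟨u, hdag, hrnd, hsrc⟩
    · exact hnv hmem
  | _ => exact ⟨by simpa [State.setLoc] using hto, by simpa [State.setLoc] using hnv⟩

/-- A newly committed vertex has been supported, and the vertices of the preceding leaders of its
round have been committed. -/
lemma Step.mem_committed (h : Step P s t) {j : Fin n} {v : Vertex n}
    (hv : v ∈ (t.loc j).committed) :
    v ∈ (s.loc j).committed ∨ (v ∈ (s.loc j).dag ∧ Supported P (s.loc j).inbox v ∧
      ∃ x : ℕ, (P.leaders v.round)[x]? = some v.source ∧
        ∀ y < x, ∃ u ∈ (s.loc j).committed,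
          u.round = v.round ∧ (P.leaders v.round)[y]? = some u.source) := by
  cases h with
  | commit i w x hi hw hx hround hprev hsupp =>
    by_cases hij : j = i
    · subst hij
      simp only [State.setLoc, Function.update_self] at hv
      rcases hv with rfl | hv
      · exact Or.inr ⟨hw, hsupp, x, hx, hprev⟩
      · exact Or.inl hv
    · simp only [State.setLoc, Function.update_of_ne hij] at hv
      exact Or.inl hv
  | _ =>
    simp only [State.setLoc, Function.update_apply] at hv
    refine Or.inl ?_
    first
      | exact hv
      | split_ifs at hv with hij
        · subst hij; exact hv
        · exact hv

/-! ### Invariants of runs -/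

lemma Reachable.inbox_subset_pool (h : Reachable P s) (j : Fin n) :
    (s.loc j).inbox ⊆ s.pool := by
  induction h generalizing j with
  | refl => simp [State.init]
  | tail _ hstep ih => exact hstep.inbox_subset_pool ih j

lemma Reachable.acted_of_rbc (h : Reachable P s) :
    ∀ j ∉ P.byz, ∀ r, s.rbc j r ≠ none → r ∈ (s.loc j).acted := by
  induction h with
  | refl => simp [State.init]
  | tail _ hstep ih => exact hstep.acted_of_rbc ih

lemma Reachable.rbc_of_mem_dag (h : Reachable P s) {j : Fin n} {v : Vertex n}
    (hv : v ∈ (s.loc j).dag) : s.rbc v.source v.round = some v := by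
  induction h with
  | refl => simp [State.init] at hv
  | tail hr hstep ih =>
    rcases hstep.mem_dag (Reachable.inbox_subset_pool hr) hv with hv | hv
    · exact hstep.rbc_stable (Reachable.acted_of_rbc hr) (ih hv)
    · exact hv.1

lemma Reachable.dag_agree (h : Reachable P s) {i j : Fin n} {v w : Vertex n}
    (hv : v ∈ (s.loc i).dag) (hw : w ∈ (s.loc j).dag)
    (hsrc : v.source = w.source) (hround : v.round = w.round) : v = w := by
  have hv' := h.rbc_of_mem_dag hv
  rw [hsrc, hround, h.rbc_of_mem_dag hw] at hv'
  exact (Option.some.inj hv').symm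

lemma Reachable.wellFormed (h : Reachable P s) {j : Fin n} {v : Vertex n}
    (hv : v ∈ (s.loc j).dag) : WellFormed P v := by
  induction h with
  | refl => simp [State.init] at hv
  | tail hr hstep ih =>
    rcases hstep.mem_dag (Reachable.inbox_subset_pool hr) hv with hv | hv
    · exact ih hv
    · exact hv.2.1

lemma Reachable.mainValid (h : Reachable P s) {j : Fin n} {v : Vertex n}
    (hv : v ∈ (s.loc j).dag) (hmain : IsMainLeaderVertex P v) :
    MainValid P s.pool (s.loc j).dag v := by
  induction h with
  | refl => simp [State.init] at hv
  | tail hr hstep ih =>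
    refine MainValid.mono hstep.pool_mono (hstep.dag_mono j) ?_
    rcases hstep.mem_dag (Reachable.inbox_subset_pool hr) hv with hv | hv
    · exact ih hv
    · exact hv.2.2 hmain

/-- An honest party that has supported a vertex never sends a timeout or no-vote message against
it, neither before nor afterwards. -/
lemma Reachable.maySupport (h : Reachable P s) {p : Fin n} (hp : p ∉ P.byz) {u : Vertex n}
    (hu : Supports s.pool p u) : MaySupport P s p u := by
  induction h with
  | refl => simp [State.init, Supports] at hu
  | tail _ hstep ih => exact hstep.maySupport hp ((hstep.supports hp hu).elim ih id)

lemma Reachable.committed_supported (h : Reachable P s) {j : Fin n} {v : Vertex n}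
    (hv : v ∈ (s.loc j).committed) : v ∈ (s.loc j).dag ∧ Supported P (s.loc j).inbox v := by
  induction h with
  | refl => simp [State.init] at hv
  | tail _ hstep ih =>
    rcases hstep.mem_committed hv with hv | hv
    · exact ⟨hstep.dag_mono j (ih hv).1, (ih hv).2.mono (hstep.inbox_mono j)⟩
    · exact ⟨hstep.dag_mono j hv.1, hv.2.1.mono (hstep.inbox_mono j)⟩

lemma Reachable.exists_leader_index (h : Reachable P s) {j : Fin n} {v : Vertex n}
    (hv : v ∈ (s.loc j).committed) :
    ∃ x : ℕ, (P.leaders v.round)[x]? = some v.source ∧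
      ∀ y < x, ∃ u ∈ (s.loc j).committed,
        u.round = v.round ∧ (P.leaders v.round)[y]? = some u.source := by
  induction h with
  | refl => simp [State.init] at hv
  | tail _ hstep ih =>
    have hold := (hstep.mem_committed hv).elim ih fun hv => hv.2.2
    obtain ⟨x, hx, hprev⟩ := hold
    refine ⟨x, hx, fun y hy => ?_⟩
    obtain ⟨u, hu, hrest⟩ := hprev y hy
    exact ⟨u, hstep.committed_mono j hu, hrest⟩

/-- If a vertex is directly committed, then the vertices of all leaders up to its own in the order of
its round have the support of a quorum. -/
lemma Reachable.exists_supported (h : Reachable P s) {j : Fin n} {v : Vertex n}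
    (hv : v ∈ (s.loc j).committed) :
    ∃ x : ℕ, (P.leaders v.round)[x]? = some v.source ∧
      ∀ y ≤ x, ∃ u, u.round = v.round ∧ (P.leaders v.round)[y]? = some u.source ∧
        Supported P s.pool u := by
  have hsupp : ∀ u ∈ (s.loc j).committed, Supported P s.pool u := fun u hu =>
    (h.committed_supported hu).2.mono (h.inbox_subset_pool j)
  obtain ⟨x, hx, hprev⟩ := h.exists_leader_index hv
  refine ⟨x, hx, fun y hy => ?_⟩
  rcases hy.lt_or_eq with hy | rfl
  · obtain ⟨u, hu, hround, hsrc⟩ := hprev y hy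
    exact ⟨u, hround, hsrc, hsupp u hu⟩
  · exact ⟨v, rfl, hx, hsupp v hv⟩

/-! ### Certificates against supported vertices -/

/-- For a supported main leader vertex there is no timeout certificate. -/
lemma Reachable.not_timeoutCert_verified (h : Reachable P s) (hf : 3 * P.f < n)
    (hbyz : P.byz.card ≤ P.f) {u : Vertex n} (hu : Supported P s.pool u)
    (hmain : IsMainLeaderVertex P u) {c : TimeoutCert n} (hround : c.round = u.round) :
    ¬ c.Verified P s.pool := by
  rintro ⟨hcard, hc⟩
  obtain ⟨Q, hQ, hsupp⟩ := hu.exists_supports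
  obtain ⟨p, hpQ, hpc, hp⟩ := exists_honest_mem_inter hf hbyz hQ hcard
  exact (h.maySupport hp (hsupp p hpQ)).2.1 ⟨hmain, hround ▸ hc p hpc⟩

/-- There is no no-vote certificate against a supported vertex. -/
lemma Reachable.not_noVoteCert_verified (h : Reachable P s) (hf : 3 * P.f < n)
    (hbyz : P.byz.card ≤ P.f) {u : Vertex n} (hu : Supported P s.pool u)
    {c : NoVoteCert n} (hround : c.round = u.round) (hleader : c.leader = u.source) :
    ¬ c.Verified P s.pool := by
  rintro ⟨hcard, hc⟩
  obtain ⟨Q, hQ, hsupp⟩ := hu.exists_supports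
  obtain ⟨p, hpQ, hpc, hp⟩ := exists_honest_mem_inter hf hbyz hQ hcard
  exact (h.maySupport hp (hsupp p hpQ)).2.2 (hround ▸ hleader ▸ hc p hpc)

/-! ### Leader paths to committed vertices -/

lemma Reachable.leaderPath_of_committed (h : Reachable P s) (hf : 3 * P.f < n)
    (hbyz : P.byz.card ≤ P.f) {i j : Fin n} {vk : Vertex n} (hvk : vk ∈ (s.loc i).committed)
    (ρ : ℕ) {vl : Vertex n} (hvl : vl.round = ρ) (hlt : vk.round < ρ)
    (hvlD : vl ∈ (s.loc j).dag) (hmain : IsMainLeaderVertex P vl) :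
    LeaderPath P (s.loc j).dag vl vk := by
  induction ρ using Nat.strong_induction_on generalizing vl with
  | _ ρ ih =>
  subst hvl
  have hvkD := (h.committed_supported hvk).1
  have hpos : 1 ≤ vk.round := (h.wellFormed hvkD).1
  obtain ⟨k, hk, hprev⟩ := h.exists_supported hvk
  obtain ⟨σ, hσ, htc, hlead⟩ := h.mainValid hvlD hmain
  rcases lt_trichotomy σ vk.round with hlt' | rfl | hgt
  · -- A timeout certificate for the round of `vk` contradicts the support of its main leader vertex.
    obtain ⟨c, -, hround, hver⟩ := htc vk.round hlt' hlt
    obtain ⟨u, hur, hus, husupp⟩ := hprev 0 (Nat.zero_le k)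
    have humain : IsMainLeaderVertex P u := by
      rwa [IsMainLeaderVertex, Params.IsMainLeader, hur, List.head?_eq_getElem?]
    exact absurd hver
      (h.not_timeoutCert_verified hf hbyz husupp humain (hround.trans hur.symm))
  · obtain ⟨x, -, -, hpath, hnvc⟩ := hlead.resolve_left (by omega)
    by_cases hkx : k < x
    · obtain ⟨u, huD, hur, hus, hup⟩ := hpath k hkx
      rw [hk] at hus
      rwa [h.dag_agree hvkD huD (Option.some.inj hus) hur.symm]
    · -- The missing leader `x` does not come after the leader of `vk`, so its vertex is supported.
      obtain ⟨u, hur, hus, husupp⟩ := hprev x (by omega)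
      rcases hnvc with hx | ⟨c, -, hround, hleader, hver⟩
      · simp [hx] at hus
      · rw [hus] at hleader
        exact absurd hver (h.not_noVoteCert_verified hf hbyz husupp (hround.trans hur.symm)
          (Option.some.inj hleader).symm)
  · obtain ⟨x, hx, -, hpath, -⟩ := hlead.resolve_left (by omega)
    obtain ⟨u, huD, hur, hus, hup⟩ := hpath 0 (by omega)
    have humain : IsMainLeaderVertex P u := by
      rwa [IsMainLeaderVertex, Params.IsMainLeader, hur, List.head?_eq_getElem?]
    exact hup.trans (ih σ hσ hur hgt huD humain)

end Angelfish

theorem mainTheorem4 {n : ℕ} (P : Angelfish.Params n)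
    (hf : 3 * P.f < n) (hbyz : P.byz.card ≤ P.f) (hleaders : ∀ r, P.leaders r ≠ [])
    (s : Angelfish.State n) (hs : Angelfish.Reachable P s)
    (i : Fin n) (hi : i ∉ P.byz)
    (r : ℕ) (vk : Angelfish.Vertex n) (hvk : vk.round = r)
    (hcommit : Angelfish.DirectlyCommits s i vk)
    (r' : ℕ) (hr' : r < r')
    (j : Fin n) (hj : j ∉ P.byz)
    (vl : Angelfish.Vertex n) (hvl : vl.round = r') (hvlD : vl ∈ (s.loc j).dag)
    (hmain : Angelfish.IsMainLeaderVertex P vl) :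
    Angelfish.LeaderPath P (s.loc j).dag vl vk :=
  hs.leaderPath_of_committed hf hbyz hcommit r' hvl (hvk ▸ hr') hvlD hmain
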